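/- The Hanna Neumann conjecture asserts that for every free group $F$ and all nontrivial finitely generated subgroups $H,K\le F$, the (finitely generated) group $H\cap K$ satisfies $$\operatorname{rank}(H\cap K)-1\;\le\;[\operatorname{rank}(H)-1]\,[\operatorname{rank}(K)-1].$$ Let $F_2=F(a,b)$ be the free group of rank $2$. For a finitely generated subgroup $H=\langle w_1,\dots,w_n\rangle\le F_2$, with the $w_i$ written as reduced words, the Stallings folding $\Gamma_H$ is the finite directed graph with edges labelled by $a,b$ that is obtained from $n$ directed cycles spelling $w_1,\dots,w_n$ from a common base vertex (a letter $x^{-1}$ being spelled by an $x$-edge traversed backwards) by repeatedly identifying pairs of edges that have the same label and the same head or the same tail; up to isomorphism it does not depend on the generators. The degree of a vertex is the number of its outgoing edges plus the number of its incoming edges (so it is at most $4$), and a branch vertex is a vertex of degree at least $3$. A vertex of degree $3$ has one of four types $C_a,C_b,C_{a^{-1}},C_{b^{-1}}$, according to which one of the four possibilities outgoing $a$-edge, outgoing $b$-edge, incoming $a$-edge, incoming $b$-edge does not occur at the vertex. **Corollary.** If the Hanna Neumann conjecture is false, then there are nontrivial finitely generated subgroups $H,K\le F_2$ for which the above inequality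 fails and such that, in addition, all branch vertices of $\Gamma_H$ and of $\Gamma_K$ have degree $3$, and all vertices of degree $3$ of $\Gamma_H$ and $\Gamma_K$ have one and the same type. -/

import Mathlib

universe u

/-- The Hanna Neumann inequality for a pair of finitely generated subgroups `H`, `K`:
`H ∩ K` is finitely generated and `rank (H ∩ K) - 1 ≤ (rank H - 1) * (rank K - 1)`
(an inequality between integers). -/
def SatisfiesHannaNeumann {F : Type*} [Group F] (H K : Subgroup F)
    [Group.FG H] [Group.FG K] : Prop :=
  ∃ _ : Group.FG ↥(H ⊓ K),
    (Group.rank ↥(H ⊓ K) : ℤ) - 1 ≤ ((Group.rank H : ℤ) - 1) * ((Group.rank K : ℤ) - 1)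

/-- `H`, `K` is a counterexample to the Hanna Neumann conjecture: two nontrivial finitely generated
subgroups which violate the Hanna Neumann inequality. -/
def IsHannaNeumannCounterexample {F : Type*} [Group F] (H K : Subgroup F) : Prop :=
  H ≠ ⊥ ∧ K ≠ ⊥ ∧ ∃ (_ : Group.FG H) (_ : Group.FG K), ¬ SatisfiesHannaNeumann H K

/-- The Hanna Neumann conjecture: any two nontrivial finitely generated subgroups of a free group
(of arbitrary rank) satisfy the Hanna Neumann inequality. -/
def HannaNeumannConjecture : Prop :=
  ∀ (F : Type u) [Group F] [IsFreeGroup F] (H K : Subgroup F) [Group.FG H] [Group.FG K],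
    H ≠ ⊥ → K ≠ ⊥ → SatisfiesHannaNeumann H K

/-- A directed graph with edges labelled by elements of `α` and a distinguished vertex `base`;
`Edge u x v` says that there is an edge labelled `x` with tail `u` and head `v`. Parallel edges with
the same label count as one edge. -/
structure LabeledGraph (α : Type*) where
  V : Type
  Edge : V → α → V → Prop
  base : V

namespace LabeledGraph

variable {α : Type*}

/-- The number of outgoing edges at `v`. -/
noncomputable def outDegree (Γ : LabeledGraph α) (v : Γ.V) : ℕ∞ :=
  {e : α × Γ.V | Γ.Edge v e.1 e.2}.encard

/-- The number of incoming edges at `v`. -/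
noncomputable def inDegree (Γ : LabeledGraph α) (v : Γ.V) : ℕ∞ :=
  {e : α × Γ.V | Γ.Edge e.2 e.1 v}.encard

/-- The undirected degree of `v`: outgoing plus incoming edges (so a loop counts twice). -/
noncomputable def degree (Γ : LabeledGraph α) (v : Γ.V) : ℕ∞ :=
  Γ.outDegree v + Γ.inDegree v

/-- A branch vertex is a vertex of undirected degree at least three. -/
def IsBranch (Γ : LabeledGraph α) (v : Γ.V) : Prop := 3 ≤ Γ.degree v

/-- The local structure of `Γ` at `v`: the set of signed labels of the edges incident to `v`.
It contains `(x, true)`, the letter `x`, if an edge labelled `x` leaves `v`, and `(x, false)`,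
the letter `x⁻¹`, if an edge labelled `x` enters `v`. -/
def localStructure (Γ : LabeledGraph α) (v : Γ.V) : Set (α × Bool) :=
  {l | if l.2 then ∃ w, Γ.Edge v l.1 w else ∃ w, Γ.Edge w l.1 v}

/-- `v` is a degree three vertex of type `C_c`, for a signed label `c`: the incident edges at `v`
carry all signed labels except `c`. -/
def HasType (Γ : LabeledGraph α) (v : Γ.V) (c : α × Bool) : Prop :=
  Γ.degree v = 3 ∧ Γ.localStructure v = {c}ᶜ

/-- The identifications of vertices forced by edge-foldings: the smallest equivalence relation such
that, whenever two edges with the same label have equivalent tails (or equivalent heads), these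
edges are identified, so that their heads (or tails) are equivalent too. -/
inductive FoldRel (Γ : LabeledGraph α) : Γ.V → Γ.V → Prop
  | refl (u : Γ.V) : FoldRel Γ u u
  | symm {u v : Γ.V} : FoldRel Γ u v → FoldRel Γ v u
  | trans {u v w : Γ.V} : FoldRel Γ u v → FoldRel Γ v w → FoldRel Γ u w
  | sameTail {u v u' v' : Γ.V} {x : α} :
      Γ.Edge u x v → Γ.Edge u' x v' → FoldRel Γ u u' → FoldRel Γ v v'
  | sameHead {u v u' v' : Γ.V} {x : α} :
      Γ.Edge u x v → Γ.Edge u' x v' → FoldRel Γ v v' → FoldRel Γ u u'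

/-- The equivalence relation of `FoldRel`. -/
def foldSetoid (Γ : LabeledGraph α) : Setoid Γ.V where
  r := Γ.FoldRel
  iseqv := ⟨FoldRel.refl, FoldRel.symm, FoldRel.trans⟩

/-- The graph that results from `Γ` by folding pairs of edges with the same label and the same tail
or the same head as long as there are any. -/
def fold (Γ : LabeledGraph α) : LabeledGraph α where
  V := Quotient Γ.foldSetoid
  Edge p x q := ∃ u v : Γ.V, Γ.Edge u x v ∧ Quotient.mk Γ.foldSetoid u = p ∧
    Quotient.mk Γ.foldSetoid v = q
  base := Quotient.mk Γ.foldSetoid Γ.base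

end LabeledGraph

section Rose

variable {α : Type*} [DecidableEq α]

/-- The vertices of the rose of the words `w 0, …, w (n - 1)`: the common base point `none`, and
`|w i| - 1` further vertices on the `i`-th cycle. -/
abbrev RoseVertex {n : ℕ} (w : Fin n → FreeGroup α) : Type :=
  Option (Σ i : Fin n, Fin ((w i).toWord.length - 1))

/-- The vertex at position `k` on the `i`-th cycle of the rose. Positions `0` and `|w i|` are the
base point. -/
def rosePoint {n : ℕ} (w : Fin n → FreeGroup α) (i : Fin n) (k : ℕ) : RoseVertex w :=
  if h : 0 < k ∧ k < (w i).toWord.length then some ⟨i, ⟨k - 1, by omega⟩⟩ else none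

/-- The rose: one cycle for each word `w i`, glued at the base point, the edges of which spell the
reduced word of `w i` from the base point on. A letter `x` is spelled by an edge labelled `x` in the
direction of reading, a letter `x⁻¹` by an edge labelled `x` in the opposite direction. -/
def rose {n : ℕ} (w : Fin n → FreeGroup α) : LabeledGraph α where
  V := RoseVertex w
  Edge u x v := ∃ (i : Fin n) (k : ℕ),
    ((w i).toWord[k]? = some (x, true) ∧ u = rosePoint w i k ∧ v = rosePoint w i (k + 1)) ∨
    ((w i).toWord[k]? = some (x, false) ∧ u = rosePoint w i (k + 1) ∧ v = rosePoint w i k)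
  base := none

/-- `Γ` is the Stallings folding of `H`, constructed from some finite generating family of `H`.
(Up to isomorphism it does not depend on the family.) -/
def IsStallingsFolding (Γ : LabeledGraph α) (H : Subgroup (FreeGroup α)) : Prop :=
  ∃ (n : ℕ) (w : Fin n → FreeGroup α),
    Subgroup.closure (Set.range w) = H ∧ Γ = (rose w).fold

end Rose

/-!
An injective homomorphism preserves ranks and intersections of subgroups, hence the failure of the
Hanna Neumann inequality (`satisfiesHannaNeumann_map_iff`). Two finitely generated subgroups of a
free group generate a countable free group, which embeds in `FreeGroup ℤ`. So it is enough to embed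
`FreeGroup ℤ` in `FreeGroup (Fin 2)` in such a way that *every* finitely generated subgroup of the
image has a Stallings folding of the required shape.

The embedding is `ladderHom`, `xₙ ↦ a²ⁿ b a b⁻¹ a⁻⁽²ⁿ⁺¹⁾`. The elements of its image are read along
closed paths in the graph `ladder`: an infinite line of `a`-edges, a `b`-edge leaving each of its
vertices, and an `a`-edge that joins the heads of the `b`-edges numbered `2n` and `2n + 1`.

```
        • --a--> •           • --a--> •
        ^        ^           ^        ^
        b        b           b        b
        |        |           |        |
... --> • --a--> • ---a----> • --a--> • --> ...
```

The branch vertices of the ladder are those of the line; they have degree three and lack only an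
incoming `b`-edge. If the words `wᵢ` are read along closed paths of a folded graph `Δ`, then their
Stallings folding maps to `Δ` (`exists_hom_of_reads`), and, both graphs being folded, each vertex of
the folding has no more signed labels than its image. So foldings that map to the ladder inherit the
two properties of its branch vertices.

Injectivity of `ladderHom` is seen from an action of `FreeGroup (Fin 2)` on
`FreeGroup ℤ × ℤ × Bool`, in which the image of `g` sends `(1, 0, false)` to `(g, 0, false)`: the
monodromy of the ladder, where the `n`-th upper edge multiplies the first component by `xₙ`.
-/

/-! ### Injective homomorphisms and the Hanna Neumann inequality -/

theorem Group.fg_iff_of_mulEquiv {G G' : Type*} [Group G] [Group G'] (e : G ≃* G') :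
    Group.FG G ↔ Group.FG G' :=
  ⟨fun _ ↦ Group.fg_of_surjective (f := e.toMonoidHom) e.surjective,
    fun _ ↦ Group.fg_of_surjective (f := e.symm.toMonoidHom) e.symm.surjective⟩

theorem satisfiesHannaNeumann_map_iff {G G' : Type*} [Group G] [Group G'] (f : G →* G')
    (hf : Function.Injective f) (H K : Subgroup G) [Group.FG H] [Group.FG K]
    [Group.FG (H.map f)] [Group.FG (K.map f)] :
    SatisfiesHannaNeumann (H.map f) (K.map f) ↔ SatisfiesHannaNeumann H K := by
  have hH := Group.rank_congr (H.equivMapOfInjective f hf)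
  have hK := Group.rank_congr (K.equivMapOfInjective f hf)
  have e : ↥(H ⊓ K) ≃* ↥(H.map f ⊓ K.map f) :=
    ((H ⊓ K).equivMapOfInjective f hf).trans
      (MulEquiv.subgroupCongr (Subgroup.map_inf H K f hf))
  constructor
  · rintro ⟨_, h⟩
    have hfg : Group.FG ↥(H ⊓ K) := (Group.fg_iff_of_mulEquiv e).mpr inferInstance
    exact ⟨hfg, by rwa [Group.rank_congr e, hH, hK]⟩
  · rintro ⟨_, h⟩
    have hfg : Group.FG ↥(H.map f ⊓ K.map f) := (Group.fg_iff_of_mulEquiv e).mp inferInstance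
    exact ⟨hfg, by rwa [← Group.rank_congr e, ← hH, ← hK]⟩

theorem isHannaNeumannCounterexample_map_iff {G G' : Type*} [Group G] [Group G'] (f : G →* G')
    (hf : Function.Injective f) (H K : Subgroup G) :
    IsHannaNeumannCounterexample (H.map f) (K.map f) ↔ IsHannaNeumannCounterexample H K := by
  have hH := Group.fg_iff_of_mulEquiv (H.equivMapOfInjective f hf)
  have hK := Group.fg_iff_of_mulEquiv (K.equivMapOfInjective f hf)
  have hbot (S : Subgroup G) : S.map f = ⊥ ↔ S = ⊥ := Subgroup.map_eq_bot_iff_of_injective S hf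
  unfold IsHannaNeumannCounterexample
  rw [Ne, hbot, Ne, hbot]
  refine and_congr_right fun _ ↦ and_congr_right fun _ ↦ ?_
  constructor
  · rintro ⟨i, j, h⟩
    have := hH.mpr i
    have := hK.mpr j
    exact ⟨‹_›, ‹_›, fun h' ↦ h ((satisfiesHannaNeumann_map_iff f hf H K).mpr h')⟩
  · rintro ⟨i, j, h⟩
    have := hH.mp i
    have := hK.mp j
    exact ⟨‹_›, ‹_›, fun h' ↦ h ((satisfiesHannaNeumann_map_iff f hf H K).mp h')⟩

theorem exists_injective_freeGroup_int (G : Type*) [Group G] [IsFreeGroup G] [Group.FG G] :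
    ∃ f : G →* FreeGroup ℤ, Function.Injective f := by
  have : Countable G := by
    obtain ⟨S, _, φ, hφ⟩ := Group.fg_iff_exists_freeGroup_hom_surjective_finite.mp ‹Group.FG G›
    exact hφ.countable
  have hof : Function.Injective (IsFreeGroup.of : IsFreeGroup.Generators G → G) :=
    (IsFreeGroup.mulEquiv G).injective.comp FreeGroup.of_injective
  have : Countable (IsFreeGroup.Generators G) := hof.countable
  obtain ⟨ι, hι⟩ := Countable.exists_injective_nat (IsFreeGroup.Generators G)
  refine ⟨(FreeGroup.map fun x ↦ (ι x : ℤ)).comp (IsFreeGroup.mulEquiv G).symm.toMonoidHom, ?_⟩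
  exact (FreeGroup.map_injective (Nat.cast_injective.comp hι)).comp
    (IsFreeGroup.mulEquiv G).symm.injective

/-- If the Hanna Neumann conjecture fails, it already fails in `FreeGroup ℤ`. -/
theorem exists_counterexample_freeGroup_int (hfalse : ¬ HannaNeumannConjecture.{u}) :
    ∃ H K : Subgroup (FreeGroup ℤ), IsHannaNeumannCounterexample H K := by
  unfold HannaNeumannConjecture at hfalse
  push Not at hfalse
  obtain ⟨F, _, _, H, K, _, _, hH, hK, h⟩ := hfalse
  have hHK : Group.FG ↥(H ⊔ K) := by
    rw [Group.fg_iff_subgroup_fg] at *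
    exact Subgroup.FG.sup ‹_› ‹_›
  obtain ⟨f, hf⟩ := exists_injective_freeGroup_int ↥(H ⊔ K)
  refine ⟨(H.subgroupOf (H ⊔ K)).map f, (K.subgroupOf (H ⊔ K)).map f, ?_⟩
  rw [isHannaNeumannCounterexample_map_iff f hf,
    ← isHannaNeumannCounterexample_map_iff (H ⊔ K).subtype (Subgroup.subtype_injective _),
    Subgroup.map_subgroupOf_eq_of_le le_sup_left, Subgroup.map_subgroupOf_eq_of_le le_sup_right]
  exact ⟨hH, hK, ‹_›, ‹_›, h⟩

/-! ### Paths in folded graphs -/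

namespace LabeledGraph

variable {α : Type*} {Γ : LabeledGraph α}

/-- `Γ.Step u l v` says that some edge leads from `u` to `v` when read along the signed label `l`:
forwards for `(x, true)`, backwards for `(x, false)`. -/
def Step (Γ : LabeledGraph α) (u : Γ.V) (l : α × Bool) (v : Γ.V) : Prop :=
  if l.2 then Γ.Edge u l.1 v else Γ.Edge v l.1 u

theorem step_not {u v : Γ.V} {x : α} {b : Bool} : Γ.Step u (x, !b) v ↔ Γ.Step v (x, b) u := by
  cases b <;> simp [Step]

theorem mem_localStructure {v : Γ.V} {l : α × Bool} :
    l ∈ Γ.localStructure v ↔ ∃ w, Γ.Step v l w := by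
  rcases l with ⟨x, _ | _⟩ <;> simp [localStructure, Step]

/-- A graph is folded if no two edges with the same label have the same tail or the same head. -/
def IsFolded (Γ : LabeledGraph α) : Prop :=
  ∀ ⦃u v w : Γ.V⦄ ⦃l : α × Bool⦄, Γ.Step u l v → Γ.Step u l w → v = w

theorem isFolded_fold (Γ : LabeledGraph α) : Γ.fold.IsFolded := by
  rintro u v w ⟨x, _ | _⟩ h h'
  · obtain ⟨p, q, e, rfl, rfl⟩ := h
    obtain ⟨p', q', e', rfl, hq⟩ := h'
    exact Quotient.sound (FoldRel.sameHead e e' (Quotient.exact hq.symm))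
  · obtain ⟨p, q, e, rfl, rfl⟩ := h
    obtain ⟨p', q', e', hp, rfl⟩ := h'
    exact Quotient.sound (FoldRel.sameTail e e' (Quotient.exact hp.symm))

theorem IsFolded.degree_eq (h : Γ.IsFolded) (v : Γ.V) :
    Γ.degree v = (Γ.localStructure v).encard := by
  have hout : Γ.outDegree v = {l ∈ Γ.localStructure v | l.2 = true}.encard := by
    have : {l ∈ Γ.localStructure v | l.2 = true} =
        (fun e : α × Γ.V ↦ (e.1, true)) '' {e | Γ.Edge v e.1 e.2} := by
      ext ⟨x, _ | _⟩ <;> simp [localStructure]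
    rw [this, Set.InjOn.encard_image]
    · rfl
    · rintro ⟨x, p⟩ hp ⟨y, q⟩ hq hxy
      obtain rfl : x = y := congrArg Prod.fst hxy
      exact Prod.ext rfl (h (l := (x, true)) hp hq)
  have hin : Γ.inDegree v = {l ∈ Γ.localStructure v | ¬ l.2 = true}.encard := by
    have : {l ∈ Γ.localStructure v | ¬ l.2 = true} =
        (fun e : α × Γ.V ↦ (e.1, false)) '' {e | Γ.Edge e.2 e.1 v} := by
      ext ⟨x, _ | _⟩ <;> simp [localStructure]
    rw [this, Set.InjOn.encard_image]
    · rfl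
    · rintro ⟨x, p⟩ hp ⟨y, q⟩ hq hxy
      obtain rfl : x = y := congrArg Prod.fst hxy
      exact Prod.ext rfl (h (l := (x, false)) hp hq)
  rw [degree, hout, hin, ← Set.encard_union_eq]
  · congr 1
    ext l
    simp only [Set.mem_union, Set.mem_ofPred_eq]
    tauto
  · exact Set.disjoint_left.mpr fun l hl hl' ↦ hl'.2 hl.2

/-- `Γ.ReadsWord u L v` says that the word `L`, reduced or not, is spelled by a path from `u` to
`v`. -/
def ReadsWord (Γ : LabeledGraph α) : Γ.V → List (α × Bool) → Γ.V → Prop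
  | u, [], v => u = v
  | u, l :: L, v => ∃ w, Γ.Step u l w ∧ ReadsWord Γ w L v

theorem readsWord_append {L M : List (α × Bool)} {u v : Γ.V} :
    Γ.ReadsWord u (L ++ M) v ↔ ∃ w, Γ.ReadsWord u L w ∧ Γ.ReadsWord w M v := by
  induction L generalizing u with
  | nil => simp [ReadsWord]
  | cons l L ih => simp only [List.cons_append, ReadsWord, ih]; tauto

theorem ReadsWord.invRev {L : List (α × Bool)} {u v : Γ.V} (h : Γ.ReadsWord u L v) :
    Γ.ReadsWord v (FreeGroup.invRev L) u := by
  induction L generalizing u with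
  | nil => exact h.symm
  | cons l L ih =>
    obtain ⟨w, hs, hw⟩ := h
    rw [FreeGroup.invRev_cons]
    exact readsWord_append.mpr ⟨w, ih hw, u, step_not.mpr hs, rfl⟩

/-- In a folded graph a path that traverses an edge and returns along the same label ends where it
began, so free reduction does not change the ends of a path. -/
theorem ReadsWord.red (hΓ : Γ.IsFolded) {L M : List (α × Bool)} (hLM : FreeGroup.Red L M)
    {u v : Γ.V} (h : Γ.ReadsWord u L v) : Γ.ReadsWord u M v := by
  induction hLM with
  | refl => exact h
  | tail _ hstep ih =>
    cases hstep
    obtain ⟨p, hp, q, hpq, r, hqr, hr⟩ := readsWord_append.mp ih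
    obtain rfl : p = r := hΓ (step_not.mpr hpq) hqr
    exact readsWord_append.mpr ⟨p, hp, hr⟩

theorem ReadsWord.exists_path {L : List (α × Bool)} {u v : Γ.V} (h : Γ.ReadsWord u L v) :
    ∃ p : ℕ → Γ.V, p 0 = u ∧ p L.length = v ∧
      ∀ k l, L[k]? = some l → Γ.Step (p k) l (p (k + 1)) := by
  induction L generalizing u with
  | nil => exact ⟨fun _ ↦ u, rfl, h, by simp⟩
  | cons l L ih =>
    obtain ⟨w, hs, hw⟩ := h
    obtain ⟨p, rfl, hv, hp⟩ := ih hw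
    refine ⟨fun k ↦ k.casesOn u p, rfl, hv, ?_⟩
    rintro (_ | k) m hm
    · obtain rfl : l = m := by simpa using hm
      exact hs
    · exact hp k m (by simpa using hm)

variable [DecidableEq α]

/-- `Γ.Reads u g v` says that the reduced word of `g` is spelled by a path from `u` to `v`. -/
def Reads (Γ : LabeledGraph α) (u : Γ.V) (g : FreeGroup α) (v : Γ.V) : Prop :=
  Γ.ReadsWord u g.toWord v

theorem Reads.one (u : Γ.V) : Γ.Reads u 1 u := by
  simp [Reads, ReadsWord]

theorem Reads.of {u v : Γ.V} {x : α} (h : Γ.Edge u x v) : Γ.Reads u (FreeGroup.of x) v := by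
  simpa [Reads, ReadsWord, Step] using h

theorem Reads.inv {u v : Γ.V} {g : FreeGroup α} (h : Γ.Reads u g v) : Γ.Reads v g⁻¹ u := by
  rw [Reads, FreeGroup.toWord_inv]
  exact ReadsWord.invRev h

theorem Reads.mul (hΓ : Γ.IsFolded) {u v w : Γ.V} {g g' : FreeGroup α} (h : Γ.Reads u g v)
    (h' : Γ.Reads v g' w) : Γ.Reads u (g * g') w := by
  rw [Reads, FreeGroup.toWord_mul]
  exact ReadsWord.red hΓ FreeGroup.reduce.red (readsWord_append.mpr ⟨v, h, h'⟩)

/-- A family of words read along closed paths of a folded graph `Δ` gives a map to `Δ` from its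
folded rose. -/
theorem exists_hom_of_reads {Δ : LabeledGraph α} (hΔ : Δ.IsFolded) {n : ℕ}
    (w : Fin n → FreeGroup α) (hw : ∀ i, Δ.Reads Δ.base (w i) Δ.base) :
    ∃ f : (rose w).fold.V → Δ.V, ∀ u x v, (rose w).fold.Edge u x v → Δ.Edge (f u) x (f v) := by
  choose p hp0 hplen hp using fun i ↦ (hw i).exists_path
  let π : (rose w).V → Δ.V := fun o ↦ o.elim Δ.base fun s ↦ p s.1 (s.2 + 1)
  have hπ (i : Fin n) (k : ℕ) (hk : k ≤ (w i).toWord.length) : π (rosePoint w i k) = p i k := by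
    unfold rosePoint
    split_ifs with h
    · exact congrArg (p i) (Nat.sub_add_cancel h.1)
    · obtain rfl | rfl : k = 0 ∨ k = (w i).toWord.length := by omega
      · exact (hp0 i).symm
      · exact (hplen i).symm
  have hedge {u v : (rose w).V} {x : α} (h : (rose w).Edge u x v) : Δ.Edge (π u) x (π v) := by
    obtain ⟨i, k, ⟨hk, rfl, rfl⟩ | ⟨hk, rfl, rfl⟩⟩ := h <;>
    · have hlt : k < (w i).toWord.length := (List.getElem?_eq_some_iff.mp hk).1
      rw [hπ i k hlt.le, hπ i (k + 1) hlt]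
      exact hp i k _ hk
  have hrel (u v : (rose w).V) (h : (rose w).FoldRel u v) : π u = π v := by
    induction h with
    | refl => rfl
    | symm _ ih => exact ih.symm
    | trans _ _ ih ih' => exact ih.trans ih'
    | @sameTail u v u' v' x e e' _ ih =>
      exact hΔ (l := (x, true)) (hedge e) (show Δ.Edge (π u) x (π v') from ih ▸ hedge e')
    | @sameHead u v u' v' x e e' _ ih =>
      exact hΔ (l := (x, false)) (hedge e) (show Δ.Edge (π u') x (π v) from ih ▸ hedge e')
  refine ⟨Quotient.lift π hrel, ?_⟩
  rintro _ x _ ⟨u, v, h, rfl, rfl⟩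
  exact hedge h

theorem exists_localStructure_subset {Δ : LabeledGraph α} (hΔ : Δ.IsFolded)
    {H : Subgroup (FreeGroup α)} (hH : ∀ g ∈ H, Δ.Reads Δ.base g Δ.base) {Γ : LabeledGraph α}
    (hΓ : IsStallingsFolding Γ H) (v : Γ.V) : ∃ u, Γ.localStructure v ⊆ Δ.localStructure u := by
  obtain ⟨n, w, rfl, rfl⟩ := hΓ
  obtain ⟨f, hf⟩ := exists_hom_of_reads hΔ w fun i ↦
    hH _ (Subgroup.subset_closure (Set.mem_range_self i))
  refine ⟨f v, ?_⟩
  rintro ⟨x, _ | _⟩ ⟨q, hq⟩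
  · exact ⟨f q, hf _ _ _ hq⟩
  · exact ⟨f q, hf _ _ _ hq⟩

end LabeledGraph

/-! ### The ladder -/

/-- The ladder: a line of `a`-edges through the vertices `(m, false)`, a `b`-edge from each
`(m, false)` to `(m, true)`, and `a`-edges from `(m, true)` to `(m + 1, true)` for even `m`. Here
`a = 0` and `b = 1`. -/
def ladder : LabeledGraph (Fin 2) where
  V := ℤ × Bool
  Edge u x v :=
    (x = 0 ∧ v = (u.1 + 1, u.2) ∧ (u.2 = true → Even u.1)) ∨
    (x = 1 ∧ u.2 = false ∧ v = (u.1, true))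
  base := (0, false)

theorem isFolded_ladder : ladder.IsFolded := by
  rintro ⟨m, s⟩ ⟨m', s'⟩ ⟨m'', s''⟩ ⟨x, _ | _⟩ h h' <;>
  · simp only [LabeledGraph.Step, ladder, Prod.mk.injEq] at h h'
    grind

theorem localStructure_ladder (v : ladder.V) :
    ladder.localStructure v ⊆ {(1, false)}ᶜ ∨ (ladder.localStructure v).encard ≤ 2 := by
  rcases v with ⟨m, _ | _⟩
  · left
    rintro l hl rfl
    obtain ⟨w, hw⟩ := LabeledGraph.mem_localStructure.mp hl
    simp [LabeledGraph.Step, ladder] at hw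
  · right
    -- an upper vertex has an incoming `b`-edge and one `a`-edge, which leaves it if `m` is even
    have : ladder.localStructure (m, true) ⊆ {(1, false), (0, decide (Even m))} := by
      intro l hl
      obtain ⟨w, hw⟩ := LabeledGraph.mem_localStructure.mp hl
      rcases l with ⟨x, _ | _⟩ <;> simp [LabeledGraph.Step, ladder] at hw ⊢ <;> grind
    exact (Set.encard_le_encard this).trans (Set.encard_pair (by simp)).le

/-- The embedding of `FreeGroup ℤ` in `FreeGroup (Fin 2)` that sends the generator `xₙ` to
`a²ⁿ b a b⁻¹ a⁻⁽²ⁿ⁺¹⁾`, which is read along the closed path of the ladder through its `n`-th upper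
edge. -/
def ladderHom : FreeGroup ℤ →* FreeGroup (Fin 2) :=
  FreeGroup.lift fun n ↦ FreeGroup.of 0 ^ (2 * n) * FreeGroup.of 1 * FreeGroup.of 0 *
    (FreeGroup.of 1)⁻¹ * (FreeGroup.of 0 ^ (2 * n + 1))⁻¹

theorem reads_ladder_zpow (k : ℤ) :
    ladder.Reads ladder.base (FreeGroup.of 0 ^ k) ((k, false) : ℤ × Bool) := by
  have hstep (m : ℤ) : ladder.Reads ((m, false) : ℤ × Bool) (FreeGroup.of 0)
      ((m + 1, false) : ℤ × Bool) := .of (by simp [ladder])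
  induction k with
  | zero => exact .one _
  | succ k ih => rw [zpow_add_one]; exact ih.mul isFolded_ladder (hstep k)
  | pred k ih =>
    rw [zpow_sub_one]
    refine ih.mul isFolded_ladder (LabeledGraph.Reads.inv ?_)
    simpa using hstep (-k - 1)

theorem reads_ladderHom (g : FreeGroup ℤ) :
    ladder.Reads ladder.base (ladderHom g) ladder.base := by
  have hof (n : ℤ) : ladder.Reads ladder.base (ladderHom (FreeGroup.of n)) ladder.base := by
    have hb (m : ℤ) : ladder.Reads ((m, false) : ℤ × Bool) (FreeGroup.of 1)
        ((m, true) : ℤ × Bool) := .of (by simp [ladder])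
    have ha : ladder.Reads ((2 * n, true) : ℤ × Bool) (FreeGroup.of 0)
        ((2 * n + 1, true) : ℤ × Bool) := .of (by simp [ladder])
    have hF := isFolded_ladder
    rw [ladderHom, FreeGroup.lift_apply_of]
    exact ((((reads_ladder_zpow (2 * n)).mul hF (hb _)).mul hF ha).mul hF (hb _).inv).mul hF
      (reads_ladder_zpow (2 * n + 1)).inv
  induction g using FreeGroup.induction_on with
  | C1 => rw [map_one]; exact .one _
  | of n => exact hof n
  | inv_of n ih => rw [map_inv]; exact ih.inv
  | mul x y hx hy => rw [map_mul]; exact hx.mul isFolded_ladder hy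

/-! ### Injectivity of the embedding -/

/-- The action of `a` in the monodromy of the ladder. The path of a word is followed from its last
letter on, so that `a` lowers the second component. Along the upper line the first component is
multiplied by a generator: from `2 * n + 1` to `2 * n` by `xₙ`, and from `2 * n + 2` to `2 * n + 1`,
where the ladder has no edge, by an arbitrary choice. -/
def ladderShift : Equiv.Perm (FreeGroup ℤ × ℤ × Bool) where
  toFun s := (if s.2.2 then FreeGroup.of (s.2.1 / 2) * s.1 else s.1, s.2.1 - 1, s.2.2)
  invFun s := (if s.2.2 then (FreeGroup.of ((s.2.1 + 1) / 2))⁻¹ * s.1 else s.1, s.2.1 + 1, s.2.2)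
  left_inv := by rintro ⟨g, m, _ | _⟩ <;> simp
  right_inv := by rintro ⟨g, m, _ | _⟩ <;> simp

/-- The action of `b` in the monodromy of the ladder: it exchanges the two lines. -/
def ladderSwap : Equiv.Perm (FreeGroup ℤ × ℤ × Bool) where
  toFun s := (s.1, s.2.1, !s.2.2)
  invFun s := (s.1, s.2.1, !s.2.2)
  left_inv := by rintro ⟨g, m, s⟩; simp
  right_inv := by rintro ⟨g, m, s⟩; simp

theorem ladderShift_zpow (k : ℤ) (g : FreeGroup ℤ) (m : ℤ) :
    (ladderShift ^ k) (g, m, false) = (g, m - k, false) := by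
  induction k generalizing m with
  | zero => simp
  | succ k ih =>
    rw [zpow_add_one, Equiv.Perm.mul_apply]
    exact (ih (m - 1)).trans (by rw [sub_sub, add_comm (1 : ℤ)])
  | pred k ih =>
    rw [zpow_sub_one, Equiv.Perm.mul_apply]
    exact (ih (m + 1)).trans (by ring_nf)

theorem injective_ladderHom : Function.Injective ladderHom := by
  let ψ : FreeGroup (Fin 2) →* Equiv.Perm (FreeGroup ℤ × ℤ × Bool) :=
    FreeGroup.lift ![ladderShift, ladderSwap]
  have hof (n : ℤ) (g : FreeGroup ℤ) :
      ψ (ladderHom (FreeGroup.of n)) (g, 0, false) = (FreeGroup.of n * g, 0, false) := by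
    have h0 : ψ (FreeGroup.of 0) = ladderShift := by simp [ψ]
    have h1 : ψ (FreeGroup.of 1) = ladderSwap := by simp [ψ]
    have hb (g : FreeGroup ℤ) (m : ℤ) : ladderSwap⁻¹ (g, m, false) = (g, m, true) := rfl
    have ha (g : FreeGroup ℤ) : ladderShift (g, 2 * n + 1, true) =
        (FreeGroup.of n * g, 2 * n, true) := by
      have : (2 * n + 1) / 2 = n := by omega
      simp [ladderShift, this]
    have hb' (g : FreeGroup ℤ) (m : ℤ) : ladderSwap (g, m, true) = (g, m, false) := rfl
    rw [ladderHom, FreeGroup.lift_apply_of]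
    simp only [map_mul, map_inv, map_zpow, h0, h1, Equiv.Perm.mul_apply]
    rw [← zpow_neg, ladderShift_zpow, zero_sub, neg_neg, hb, ha, hb', ladderShift_zpow, sub_self]
  have key (w g : FreeGroup ℤ) : ψ (ladderHom w) (g, 0, false) = (w * g, 0, false) := by
    induction w using FreeGroup.induction_on generalizing g with
    | C1 => simp
    | of n => exact hof n g
    | inv_of n ih =>
      rw [map_inv, map_inv, Equiv.Perm.inv_eq_iff_eq, ih, mul_inv_cancel_left]
    | mul x y hx hy => rw [map_mul, map_mul, Equiv.Perm.mul_apply, hy, hx, mul_assoc]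
  intro x y hxy
  have h := key x 1
  rw [hxy, key y 1] at h
  simpa using (congrArg Prod.fst h).symm

/-! ### Stallings foldings of subgroups of the image -/

theorem degree_of_le_range_ladderHom {H : Subgroup (FreeGroup (Fin 2))}
    (hH : H ≤ ladderHom.range) {Γ : LabeledGraph (Fin 2)} (hΓ : IsStallingsFolding Γ H) (v : Γ.V) :
    Γ.degree v ≤ 3 ∧ (Γ.degree v = 3 → Γ.HasType v (1, false)) := by
  have hreads : ∀ g ∈ H, ladder.Reads ladder.base g ladder.base := by
    intro g hg
    obtain ⟨x, rfl⟩ := hH hg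
    exact reads_ladderHom x
  obtain ⟨u, hu⟩ := LabeledGraph.exists_localStructure_subset isFolded_ladder hreads hΓ v
  have hdeg : Γ.degree v = (Γ.localStructure v).encard := by
    obtain ⟨n, w, -, rfl⟩ := hΓ
    exact (LabeledGraph.isFolded_fold _).degree_eq v
  have hcard : ({(1, false)}ᶜ : Set (Fin 2 × Bool)).encard = 3 := by
    rw [← Finset.coe_singleton, ← Finset.coe_compl, Set.encard_coe_eq_coe_finsetCard]
    rfl
  rcases localStructure_ladder u with h | h
  · have hsub := hu.trans h
    refine ⟨hdeg ▸ hcard ▸ Set.encard_le_encard hsub, fun h3 ↦ ⟨h3, ?_⟩⟩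
    exact (Set.toFinite _).eq_of_subset_of_encard_le hsub (by rw [hcard, ← hdeg, h3])
  · have h2 : Γ.degree v ≤ 2 := hdeg ▸ (Set.encard_le_encard hu).trans h
    have h23 : (2 : ℕ∞) < 3 := by norm_num
    exact ⟨h2.trans h23.le, fun h3 ↦ absurd h2 (h3 ▸ h23.not_ge)⟩

theorem corollary4 (hfalse : ¬ HannaNeumannConjecture.{u}) :
    ∃ H K : Subgroup (FreeGroup (Fin 2)),
      IsHannaNeumannCounterexample H K ∧
      (∀ Γ : LabeledGraph (Fin 2), (IsStallingsFolding Γ H ∨ IsStallingsFolding Γ K) →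
        ∀ v : Γ.V, Γ.IsBranch v → Γ.degree v = 3) ∧
      ∃ c : Fin 2 × Bool,
        ∀ Γ : LabeledGraph (Fin 2), (IsStallingsFolding Γ H ∨ IsStallingsFolding Γ K) →
          ∀ v : Γ.V, Γ.degree v = 3 → Γ.HasType v c := by
  obtain ⟨H, K, hHK⟩ := exists_counterexample_freeGroup_int hfalse
  have key (Γ : LabeledGraph (Fin 2))
      (hΓ : IsStallingsFolding Γ (H.map ladderHom) ∨ IsStallingsFolding Γ (K.map ladderHom))
      (v : Γ.V) : Γ.degree v ≤ 3 ∧ (Γ.degree v = 3 → Γ.HasType v (1, false)) :=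
    hΓ.elim (fun h ↦ degree_of_le_range_ladderHom (Subgroup.map_le_range _ _) h v)
      fun h ↦ degree_of_le_range_ladderHom (Subgroup.map_le_range _ _) h v
  exact ⟨H.map ladderHom, K.map ladderHom,
    (isHannaNeumannCounterexample_map_iff _ injective_ladderHom H K).mpr hHK,
    fun Γ hΓ v hv ↦ (key Γ hΓ v).1.antisymm hv, (1, false), fun Γ hΓ v ↦ (key Γ hΓ v).2⟩
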